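/- Let $(\widetilde M,G)$ be a closed (compact, boundaryless) smooth $n$-dimensional Riemannian manifold, $T>0$, and let $M=\widetilde M\times(0,T)$ carry the Minkowski metric $g=-dt^2+G$, i.e. $(g_{\mu\nu})=\mathrm{diag}(-1,G)$, with Levi-Civita connection $\nabla$ and volume element $\sqrt{-g}\,dx$. Let $(\cdot,\cdot)$ be the (indefinite) pairing of tensors induced by $g$. A measurable tensor field is in $L^2$ if its pointwise norm in the positive definite metric $dt^2+G$ is square integrable, and in $H^1$ if it and its weak covariant derivative are in $L^2$. Let $T^k_rM$ denote the bundle of tensors with $k$ contravariant and $r$ covariant indices, and let $k+r\ge 1$. Consider either of the following two settings: (a) $k\ge 1$, $A$ is a vector field on $M$, $\widetilde E=T^{k-1}_rM$, and $\nabla_A\psi=\nabla\psi+\psi\otimes A$, where the index of the derivative is raised with $g$; (b) $r\ge 1$, $A$ is a covector field on $M$, $\widetilde E=T^k_{r-1}M$, and $\nabla_A\psi=\nabla\psi+\psi\otimes A$. For $v\in L^2(T^k_rM)$, the condition $\mathrm{div}_A v=0$ means that $\int_M(\nabla_A\psi,v)\sqrt{-g}\,dx=0$ for all $\psi\in H^1(\widetilde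 E)$ with $\nabla_A\psi\in L^2(T^k_rM)$. (If $A$ is measurable and bounded with respect to $dt^2+G$, then $\nabla_A\psi\in L^2$ for every $\psi\in H^1$.) Let $u\in L^2(T^k_rM)$. Then, in each setting, $u$ has an orthogonal decomposition $$u=\nabla_A\varphi+v,\qquad \mathrm{div}_A v=0,\qquad \int_M(\nabla_A\varphi,v)\sqrt{-g}\,dx=0,$$ with $\varphi\in H^1(\widetilde E)$ and $\nabla_A\varphi,v\in L^2(T^k_rM)$, if and only if the hyperbolic equation $\mathrm{div}_A\nabla_A\varphi=\mathrm{div}_A u$ has a weak solution, i.e. there is $\varphi\in H^1(\widetilde E)$ with $\nabla_A\varphi\in L^2(T^k_rM)$ such that $$\int_M(\nabla_A\varphi,\nabla_A\psi)\sqrt{-g}\,dx=\int_M(u,\nabla_A\psi)\sqrt{-g}\,dx$$ for all $\psi\in H^1(\widetilde E)$ with $\nabla_A\psi\in L^2(T^k_rM)$. -/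

import Mathlib

open MeasureTheory Set
open scoped Manifold ContDiff Topology

noncomputable section

namespace MinkowskiDecomposition

/-! ### Tensor algebra on a real vector space -/

section Algebra

variable {V : Type*} [AddCommGroup V] [Module ℝ V]

/-- `(k, r)`-tensors on `V` (`k` contravariant and `r` covariant indices): real valued maps of `k`
covectors and `r` vectors, linear in each argument. -/
abbrev Tensor (V : Type*) [AddCommGroup V] [Module ℝ V] (k r : ℕ) : Type _ :=
  MultilinearMap ℝ (fun _ : Fin k => Module.Dual ℝ V) (MultilinearMap ℝ (fun _ : Fin r => V) ℝ)

/-- `f ⊗ A` for a covector `A`; the new covariant slot is the last one. -/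
def Tensor.mulCovector {k r : ℕ} (f : Tensor V k r) (A : Module.Dual ℝ V) : Tensor V k (r + 1) :=
  LinearMap.compMultilinearMap
    { toFun := fun h => (h.smulRight A).uncurryRight
      map_add' := fun h h' => by ext v; simp [add_mul]
      map_smul' := fun c h => by ext v; simp [mul_assoc] } f

/-- `f ⊗ X` for a vector `X`; the new contravariant slot is the last one. -/
def Tensor.mulVector {k r : ℕ} (f : Tensor V k r) (X : V) : Tensor V (k + 1) r :=
  ((LinearMap.smulRightₗ (Module.Dual.eval ℝ V X)).compMultilinearMap f).uncurryRight

variable {ι : Type*} [Fintype ι] [DecidableEq ι]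

/-- The matrix `g_{ij}` of a bilinear form in a basis. -/
def gram (b : Module.Basis ι ℝ V) (g : LinearMap.BilinForm ℝ V) : Matrix ι ι ℝ :=
  Matrix.of fun i j => g (b i) (b j)

/-- The index-raising map `α ↦ g^{ij} α_i b_j` from covectors to vectors. -/
def sharp (b : Module.Basis ι ℝ V) (g : LinearMap.BilinForm ℝ V) : Module.Dual ℝ V →ₗ[ℝ] V :=
  ∑ i, ∑ j, ((gram b g)⁻¹ i j) • (Module.Dual.eval ℝ V (b i)).smulRight (b j)

/-- Raise the last covariant index of `f` with `g`, making it the last contravariant index. -/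
def Tensor.raiseLast (b : Module.Basis ι ℝ V) (g : LinearMap.BilinForm ℝ V) {k r : ℕ}
    (f : Tensor V k (r + 1)) : Tensor V (k + 1) r :=
  ((LinearMap.mk₂ ℝ
      (fun (h : MultilinearMap ℝ (fun _ : Fin (r + 1) => V) ℝ) (α : Module.Dual ℝ V) =>
        (LinearMap.applyₗ (R := ℝ) (M₂ := ℝ) (sharp b g α)).compMultilinearMap h.curryRight)
      (fun h h' α => by ext v; simp)
      (fun c h α => by ext v; simp)
      (fun h α α' => by ext v; simp)
      (fun c h α => by ext v; simp)).compMultilinearMap f).uncurryRight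

/-- The components `f^{I}_{J}` of a tensor in a basis. -/
def Tensor.coeff (b : Module.Basis ι ℝ V) {k r : ℕ} (f : Tensor V k r)
    (I : Fin k → ι) (J : Fin r → ι) : ℝ :=
  f (fun a => b.coord (I a)) (fun c => b (J c))

/-- The pairing of `(k, r)`-tensors induced by `g`:
`g_{i₁ i₁'} ⋯ g_{iₖ iₖ'} g^{j₁ j₁'} ⋯ g^{jᵣ jᵣ'} f^{i₁ … iₖ}_{j₁ … jᵣ} h^{i₁' … iₖ'}_{j₁' … jᵣ'}`.
It does not depend on the basis. -/
def tensorPairing (b : Module.Basis ι ℝ V) (g : LinearMap.BilinForm ℝ V) {k r : ℕ}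
    (f h : Tensor V k r) : ℝ :=
  ∑ I : Fin k → ι, ∑ I' : Fin k → ι, ∑ J : Fin r → ι, ∑ J' : Fin r → ι,
    (∏ a, gram b g (I a) (I' a)) * (∏ c, (gram b g)⁻¹ (J c) (J' c)) *
      f.coeff b I J * h.coeff b I' J'

end Algebra

/-! ### The space-time `M × (0, T)` -/

/-- The open interval `(0, T)` as a one-dimensional manifold. -/
abbrev TimeInterval (T : ℝ) : TopologicalSpace.Opens ℝ := ⟨Ioo 0 T, isOpen_Ioo⟩

/-- The cylinder `M × (0, T)`. -/
abbrev Spacetime (M : Type*) (T : ℝ) : Type _ := M × TimeInterval T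

/-- The coordinate space `ℝⁿ × ℝ`, with coordinates `(x, t)`. -/
abbrev Model (n : ℕ) : Type := EuclideanSpace ℝ (Fin n) × ℝ

/-- The model with corners of the product manifold `M × (0, T)`; there is no boundary. -/
abbrev stModel (n : ℕ) :
    ModelWithCorners ℝ (Model n) (ModelProd (EuclideanSpace ℝ (Fin n)) ℝ) :=
  (𝓡 n).prod 𝓘(ℝ, ℝ)

/-- The standard basis of `ℝⁿ × ℝ`. -/
def stBasis (n : ℕ) : Module.Basis (Fin n ⊕ Unit) ℝ (Model n) :=
  (EuclideanSpace.basisFun (Fin n) ℝ).toBasis.prod (Module.Basis.singleton Unit ℝ)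

section Spacetime

variable {n : ℕ} {M : Type*} [TopologicalSpace M] [ChartedSpace (EuclideanSpace ℝ (Fin n)) M]
  {T : ℝ}

variable (n) in
/-- The tangent space of `M × (0, T)` at `p`. -/
abbrev Tan (p : Spacetime M T) : Type := TangentSpace (stModel n) p

variable (n) in
/-- The standard basis of the model space as a basis of the tangent space at `p`. -/
def tanBasis (p : Spacetime M T) : Module.Basis (Fin n ⊕ Unit) ℝ (Tan n p) := stBasis n

variable (n M T) in
/-- `(k, r)`-tensor fields on `M × (0, T)`, without any regularity. -/
abbrev TensorField (k r : ℕ) : Type _ := ∀ p : Spacetime M T, Tensor (Tan n p) k r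

/-- Smooth Riemannian metrics on the spatial manifold `M`. -/
abbrev SpatialMetric (n : ℕ) (M : Type*) [TopologicalSpace M]
    [ChartedSpace (EuclideanSpace ℝ (Fin n)) M] [IsManifold (𝓡 n) ∞ M] : Type _ :=
  Bundle.ContMDiffRiemannianMetric (𝓡 n) ∞ (EuclideanSpace ℝ (Fin n))
    (fun x : M => TangentSpace (𝓡 n) x)

variable [IsManifold (𝓡 n) ∞ M]

variable (n) in
/-- The spatial part of a tangent vector of `M × (0, T)`. -/
def spacePart (p : Spacetime M T) : Tan n p →ₗ[ℝ] TangentSpace (𝓡 n) p.1 :=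
  LinearMap.fst ℝ (EuclideanSpace ℝ (Fin n)) ℝ

variable (n) in
/-- The time part `dt(v)` of a tangent vector `v` of `M × (0, T)`. -/
def timePart (p : Spacetime M T) : Tan n p →ₗ[ℝ] ℝ :=
  LinearMap.snd ℝ (EuclideanSpace ℝ (Fin n)) ℝ

/-- The product metric `s dt² + G` on `M × (0, T)`. -/
def productMetric (s : ℝ) (G : SpatialMetric n M) (p : Spacetime M T) :
    LinearMap.BilinForm ℝ (Tan n p) :=
  LinearMap.mk₂ ℝ
    (fun v w => s * (timePart n p v * timePart n p w)
      + G.inner p.1 (spacePart n p v) (spacePart n p w))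
    (fun v v' w => by simp only [map_add, add_apply]; ring)
    (fun c v w => by
      simp only [map_smul, smul_apply, smul_eq_mul]; ring)
    (fun v w w' => by simp only [map_add]; ring)
    (fun c v w => by simp only [map_smul, smul_eq_mul]; ring)

/-- The Minkowski metric `-dt² + G`. -/
def minkowskiMetric (G : SpatialMetric n M) (p : Spacetime M T) : LinearMap.BilinForm ℝ (Tan n p) :=
  productMetric (-1) G p

/-- The positive definite metric `dt² + G`, used to measure the size of tensors. -/
def referenceMetric (G : SpatialMetric n M) (p : Spacetime M T) : LinearMap.BilinForm ℝ (Tan n p) :=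
  productMetric 1 G p

/-! ### Coordinates: the charts `extChartAt x₀` cover the manifold -/

variable (n) in
/-- The coordinate vector field `∂_i` of the chart at `x₀`, at the point `p` of the chart domain
(the trivialization of the tangent bundle at `x₀` is the derivative of the chart at `x₀`). -/
def coordVector (x₀ p : Spacetime M T) (i : Fin n ⊕ Unit) : Tan n p :=
  (trivializationAt (Model n) (TangentSpace (stModel n)) x₀).symmL ℝ p (stBasis n i)

variable (n) in
/-- The coordinate covector field `dx^i` of the chart at `x₀`, at the point `p`. -/
def coordCovector (x₀ p : Spacetime M T) (i : Fin n ⊕ Unit) : Module.Dual ℝ (Tan n p) :=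
  (stBasis n).coord i ∘ₗ
    ((trivializationAt (Model n) (TangentSpace (stModel n)) x₀).continuousLinearMapAt ℝ p :
      Tan n p →ₗ[ℝ] Model n)

/-- The components `u^{I}_{J}` of a tensor field in the chart at `x₀`, at the point `p`. -/
def chartCoeff {k r : ℕ} (x₀ : Spacetime M T) (u : TensorField n M T k r)
    (I : Fin k → Fin n ⊕ Unit) (J : Fin r → Fin n ⊕ Unit) (p : Spacetime M T) : ℝ :=
  u p (fun a => coordCovector n x₀ p (I a)) (fun c => coordVector n x₀ p (J c))

/-- The matrix `g_{ij}` of the Minkowski metric in the chart at `x₀`, as a function of the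
coordinates `y`. -/
def chartMetric (G : SpatialMetric n M) (x₀ : Spacetime M T) (y : Model n) :
    Matrix (Fin n ⊕ Unit) (Fin n ⊕ Unit) ℝ :=
  Matrix.of fun i j =>
    minkowskiMetric G ((extChartAt (stModel n) x₀).symm y)
      (coordVector n x₀ ((extChartAt (stModel n) x₀).symm y) i)
      (coordVector n x₀ ((extChartAt (stModel n) x₀).symm y) j)

/-- The Christoffel symbol `Γ^l_{ij}` of the Levi-Civita connection of the Minkowski metric. -/
def christoffel (G : SpatialMetric n M) (x₀ : Spacetime M T) (l i j : Fin n ⊕ Unit)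
    (y : Model n) : ℝ :=
  (1 / 2 : ℝ) * ∑ m, (chartMetric G x₀ y)⁻¹ l m *
    (fderiv ℝ (fun z => chartMetric G x₀ z m j) y (stBasis n i)
      + fderiv ℝ (fun z => chartMetric G x₀ z m i) y (stBasis n j)
      - fderiv ℝ (fun z => chartMetric G x₀ z i j) y (stBasis n m))

/-! ### Volume and square-integrable tensor fields -/

section Measure

variable [MeasurableSpace M]

/-- The volume measure `√(-det g) dx` of `M × (0, T)`: each chart carries the measure with this
density, and the volume measure is the least measure that dominates all of them (they agree where
chart domains overlap, so that it restricts to each of them). -/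
def volumeMeasure (T : ℝ) (G : SpatialMetric n M) : Measure (Spacetime M T) :=
  ⨆ x₀ : Spacetime M T,
    (((volume : Measure (Model n)).restrict (extChartAt (stModel n) x₀).target).withDensity
      (fun y => ENNReal.ofReal (Real.sqrt (-(chartMetric G x₀ y).det)))).map
        (extChartAt (stModel n) x₀).symm

/-- `u ∈ L²`: the components of `u` in each chart are measurable, and `∫ |u|² < ∞`, with `|u|`
taken in the positive definite metric `dt² + G`. -/
def MemL2 (G : SpatialMetric n M) {k r : ℕ} (u : TensorField n M T k r) : Prop :=
  (∀ (x₀ : Spacetime M T) (I : Fin k → Fin n ⊕ Unit) (J : Fin r → Fin n ⊕ Unit),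
      AEStronglyMeasurable (chartCoeff x₀ u I J)
        ((volumeMeasure T G).restrict (extChartAt (stModel n) x₀).source)) ∧
    ∫⁻ p, ENNReal.ofReal (tensorPairing (tanBasis n p) (referenceMetric G p) (u p) (u p))
      ∂(volumeMeasure T G) < ⊤

/-- `∫_M (u, v) √(-g) dx`, where `(u, v)` is the indefinite pairing induced by the Minkowski
metric. -/
def pairing (G : SpatialMetric n M) {k r : ℕ} (u v : TensorField n M T k r) : ℝ :=
  ∫ p, tensorPairing (tanBasis n p) (minkowskiMetric G p) (u p) (v p) ∂(volumeMeasure T G)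

end Measure

/-! ### Weak derivatives and `H¹` -/

/-- `h` is the weak partial derivative of `f` in the direction of the coordinate `i` on the open
set `Ω` of the coordinate space. -/
def IsWeakPartial (Ω : Set (Model n)) (i : Fin n ⊕ Unit) (f h : Model n → ℝ) : Prop :=
  LocallyIntegrableOn f Ω ∧ LocallyIntegrableOn h Ω ∧
    ∀ η : Model n → ℝ, ContDiff ℝ ∞ η → HasCompactSupport η → tsupport η ⊆ Ω →
      ∫ y in Ω, f y * fderiv ℝ η y (stBasis n i) = -∫ y in Ω, h y * η y

/-- `dψ = ∇ψ` weakly, where `∇` is the Levi-Civita covariant derivative and the last covariant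
index of `dψ` is that of the derivative: in every chart
`∂_m ψ^I_J = (dψ)^I_{J m} - ∑_a Γ^{I_a}_{m l} ψ^{I[a ↦ l]}_J + ∑_c Γ^l_{m J_c} ψ^I_{J[c ↦ l]}`
weakly. -/
def IsWeakCovDeriv (G : SpatialMetric n M) {k r : ℕ} (ψ : TensorField n M T k r)
    (dψ : TensorField n M T k (r + 1)) : Prop :=
  ∀ (x₀ : Spacetime M T) (I : Fin k → Fin n ⊕ Unit) (J : Fin r → Fin n ⊕ Unit)
    (m : Fin n ⊕ Unit),
    IsWeakPartial (extChartAt (stModel n) x₀).target m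
      (fun y => chartCoeff x₀ ψ I J ((extChartAt (stModel n) x₀).symm y))
      (fun y =>
        chartCoeff x₀ dψ I (Fin.snoc (α := fun _ => Fin n ⊕ Unit) J m)
            ((extChartAt (stModel n) x₀).symm y)
          - ∑ a, ∑ l, christoffel G x₀ (I a) m l y *
              chartCoeff x₀ ψ (Function.update I a l) J ((extChartAt (stModel n) x₀).symm y)
          + ∑ c, ∑ l, christoffel G x₀ l m (J c) y *
              chartCoeff x₀ ψ I (Function.update J c l) ((extChartAt (stModel n) x₀).symm y))

/-- `ψ ∈ H¹`: `ψ` and its weak covariant derivative are in `L²`. -/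
def MemH1 [MeasurableSpace M] (G : SpatialMetric n M) {k r : ℕ} (ψ : TensorField n M T k r) :
    Prop :=
  MemL2 G ψ ∧ ∃ dψ : TensorField n M T k (r + 1), IsWeakCovDeriv G ψ dψ ∧ MemL2 G dψ

/-! ### The operators `∇_A` -/

/-- `w = ∇_A ψ = ∇ψ + ψ ⊗ A` for a covector field `A` and a `(k, r)`-tensor field `ψ`, as a
`(k, r + 1)`-tensor field. -/
def IsCovariantAGrad (G : SpatialMetric n M) (A : ∀ p : Spacetime M T, Module.Dual ℝ (Tan n p))
    {k r : ℕ} (ψ : TensorField n M T k r) (w : TensorField n M T k (r + 1)) : Prop :=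
  ∃ dψ : TensorField n M T k (r + 1), IsWeakCovDeriv G ψ dψ ∧
    ∀ p, w p = dψ p + (ψ p).mulCovector (A p)

/-- `w = ∇_A ψ = ∇ψ + ψ ⊗ A` for a vector field `A` and a `(k, r)`-tensor field `ψ`, as a
`(k + 1, r)`-tensor field: here the index of the derivative is raised with the Minkowski metric. -/
def IsContravariantAGrad (G : SpatialMetric n M) (A : ∀ p : Spacetime M T, Tan n p)
    {k r : ℕ} (ψ : TensorField n M T k r) (w : TensorField n M T (k + 1) r) : Prop :=
  ∃ dψ : TensorField n M T k (r + 1), IsWeakCovDeriv G ψ dψ ∧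
    ∀ p, w p = (dψ p).raiseLast (tanBasis n p) (minkowskiMetric G p) + (ψ p).mulVector (A p)

/-! ### Decomposition and weak solutions

`AGrad ψ w` stands for one of the two relations `w = ∇_A ψ` above. -/

section Problem

variable [MeasurableSpace M] (G : SpatialMetric n M) {k' r' k r : ℕ}
  (AGrad : TensorField n M T k' r' → TensorField n M T k r → Prop)

/-- `div_A v = 0`: `∫ (∇_A ψ, v) = 0` for all `ψ ∈ H¹` with `∇_A ψ ∈ L²`. -/
def IsDivAFree (v : TensorField n M T k r) : Prop :=
  ∀ (ψ : TensorField n M T k' r') (z : TensorField n M T k r),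
    MemH1 G ψ → AGrad ψ z → MemL2 G z → pairing G z v = 0

/-- `u = ∇_A φ + v` with `φ ∈ H¹`, `∇_A φ, v ∈ L²`, `div_A v = 0` and `∫ (∇_A φ, v) = 0`. -/
def HasOrthogonalDecomposition (u : TensorField n M T k r) : Prop :=
  ∃ (φ : TensorField n M T k' r') (w v : TensorField n M T k r),
    MemH1 G φ ∧ AGrad φ w ∧ MemL2 G w ∧ MemL2 G v ∧
      (∀ᵐ p ∂(volumeMeasure T G), u p = w p + v p) ∧
      IsDivAFree G AGrad v ∧ pairing G w v = 0

/-- `div_A ∇_A φ = div_A u` has a weak solution `φ ∈ H¹` (with `∇_A φ ∈ L²`):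
`∫ (∇_A φ, ∇_A ψ) = ∫ (u, ∇_A ψ)` for all `ψ ∈ H¹` with `∇_A ψ ∈ L²`. -/
def HasWeakSolution (u : TensorField n M T k r) : Prop :=
  ∃ (φ : TensorField n M T k' r') (w : TensorField n M T k r),
    MemH1 G φ ∧ AGrad φ w ∧ MemL2 G w ∧
      ∀ (ψ : TensorField n M T k' r') (z : TensorField n M T k r),
        MemH1 G ψ → AGrad ψ z → MemL2 G z → pairing G w z = pairing G u z

end Problem

end Spacetime

end MinkowskiDecomposition

end

open MinkowskiDecomposition

/-!
The equivalence is algebra once the pairing `∫ (u, v) √(-g) dx` is known to be a symmetric bilinear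
form on `L²`: given a decomposition `u = ∇_A φ + v`, pairing it with `∇_A ψ` kills `v`; conversely,
if `φ` is a weak solution, then `v = u - ∇_A φ` satisfies `div_A v = 0`, and testing this with
`ψ = φ` gives the orthogonality. Nothing is used about `∇_A` beyond its being a relation between
tensor fields, so both settings are instances of `hasOrthogonalDecomposition_iff_hasWeakSolution`.

Since the Bochner integral of a non-integrable function is `0`, bilinearity requires that `(u, v)`
be integrable for `u, v ∈ L²` (`MemL2.integrable_minkowski`). Two facts give this, and both rest on
the pairing of tensors being independent of the basis (`tensorPairing_change_basis`).

* Bound: in a basis that is orthonormal for `dt² + G` and contains `∂_t`, both `dt² + G` and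
  `-dt² + G` are diagonal with entries `±1`, so that `|(f, h)| ≤ |f|² + |h|²`, with the norms of
  `dt² + G` (`abs_tensorPairing_minkowski_le`).
* Measurability: in the coordinate frame of a chart the components of the metric are continuous
  (`continuousOn_productMetric`) and those of the tensor fields are measurable by assumption;
  countably many charts cover the space-time (`aemeasurable_of_charts`).
-/

namespace MinkowskiDecomposition

/-! ### Basis independence of the pairing of tensors -/

open scoped Kronecker Matrix

section TensorPower
variable {ι : Type*}

/-- The `k`-fold tensor power of a square matrix, indexed by multi-indices. -/
noncomputable def matrixPower (k : ℕ) (A : Matrix ι ι ℝ) : Matrix (Fin k → ι) (Fin k → ι) ℝ :=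
  Matrix.of fun I J => ∏ a, A (I a) (J a)

theorem matrixPower_mul [Fintype ι] (k : ℕ) (A B : Matrix ι ι ℝ) :
    matrixPower k (A * B) = matrixPower k A * matrixPower k B := by
  classical
  ext I J
  simp only [matrixPower, Matrix.of_apply, Matrix.mul_apply, Finset.prod_univ_sum,
    Finset.prod_mul_distrib, Fintype.piFinset_univ]

theorem matrixPower_transpose (k : ℕ) (A : Matrix ι ι ℝ) :
    matrixPower k Aᵀ = (matrixPower k A)ᵀ := rfl

end TensorPower

section Algebra
variable {V : Type*} [AddCommGroup V] [Module ℝ V] {ι : Type*} {k r : ℕ}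

/-- The components of a tensor as a vector indexed by pairs of multi-indices. -/
noncomputable def coeffVec (b : Module.Basis ι ℝ V) (f : Tensor V k r) :
    (Fin k → ι) × (Fin r → ι) → ℝ :=
  fun K => f.coeff b K.1 K.2

theorem coeffVec_add (b : Module.Basis ι ℝ V) (f h : Tensor V k r) :
    coeffVec b (f + h) = coeffVec b f + coeffVec b h := rfl

theorem coeffVec_sub (b : Module.Basis ι ℝ V) (f h : Tensor V k r) :
    coeffVec b (f - h) = coeffVec b f - coeffVec b h := rfl

variable [Fintype ι] [DecidableEq ι]

/-- The matrix of the bilinear form induced on `(k, r)`-tensors. -/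
noncomputable def pairingMatrix (b : Module.Basis ι ℝ V) (g : LinearMap.BilinForm ℝ V) (k r : ℕ) :
    Matrix ((Fin k → ι) × (Fin r → ι)) ((Fin k → ι) × (Fin r → ι)) ℝ :=
  matrixPower k (gram b g) ⊗ₖ matrixPower r (gram b g)⁻¹

theorem tensorPairing_eq_dotProduct (b : Module.Basis ι ℝ V) (g : LinearMap.BilinForm ℝ V)
    (f h : Tensor V k r) :
    tensorPairing b g f h = coeffVec b f ⬝ᵥ (pairingMatrix b g k r *ᵥ coeffVec b h) := by
  simp only [tensorPairing, dotProduct, Matrix.mulVec, pairingMatrix, Fintype.sum_prod_type,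
    Matrix.kroneckerMap_apply, matrixPower, Matrix.of_apply, coeffVec, Finset.mul_sum]
  refine Finset.sum_congr rfl fun I _ => ?_
  rw [Finset.sum_comm]
  refine Finset.sum_congr rfl fun J _ => Finset.sum_congr rfl fun I' _ =>
    Finset.sum_congr rfl fun J' _ => by ring

theorem tensorPairing_add_left (b : Module.Basis ι ℝ V) (g : LinearMap.BilinForm ℝ V)
    (f f' h : Tensor V k r) :
    tensorPairing b g (f + f') h = tensorPairing b g f h + tensorPairing b g f' h := by
  simp only [tensorPairing_eq_dotProduct, coeffVec_add, add_dotProduct]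

theorem tensorPairing_sub_left (b : Module.Basis ι ℝ V) (g : LinearMap.BilinForm ℝ V)
    (f f' h : Tensor V k r) :
    tensorPairing b g (f - f') h = tensorPairing b g f h - tensorPairing b g f' h := by
  simp only [tensorPairing_eq_dotProduct, coeffVec_sub, sub_dotProduct]

theorem gram_change_basis (b b' : Module.Basis ι ℝ V) (g : LinearMap.BilinForm ℝ V) :
    gram b' g = (b.toMatrix b')ᵀ * gram b g * b.toMatrix b' := by
  have h : ∀ c : Module.Basis ι ℝ V, gram c g = LinearMap.BilinForm.toMatrix c g := fun c => by
    ext i j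
    simp [gram, LinearMap.BilinForm.toMatrix_apply]
  rw [h, h, LinearMap.BilinForm.toMatrix_mul_basis_toMatrix]

/-- Components transform by the change of basis matrix in covariant slots and by its inverse in
contravariant slots. -/
theorem coeffVec_change_basis (b b' : Module.Basis ι ℝ V) (f : Tensor V k r) :
    coeffVec b' f =
      (matrixPower k (b'.toMatrix b) ⊗ₖ matrixPower r (b.toMatrix b')ᵀ) *ᵥ coeffVec b f := by
  classical
  ext ⟨I', J'⟩
  have h1 : ∀ i', b'.coord i' = ∑ i, b'.toMatrix b i' i • b.coord i := by
    intro i'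
    refine b.ext fun j => ?_
    simp [Module.Basis.toMatrix_apply, Finsupp.single_apply]
  have h2 : ∀ j', b' j' = ∑ j, b.toMatrix b' j j' • b j := by
    intro j'
    simp
  simp only [coeffVec, Tensor.coeff, Matrix.mulVec, dotProduct, Fintype.sum_prod_type,
    Matrix.kroneckerMap_apply, matrixPower, Matrix.of_apply, Matrix.transpose_apply]
  have e1 : (fun a => b'.coord (I' a)) = fun a => ∑ i, b'.toMatrix b (I' a) i • b.coord i :=
    funext fun a => h1 (I' a)
  have e2 : (fun c => b' (J' c)) = fun c => ∑ j, b.toMatrix b' j (J' c) • b j :=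
    funext fun c => h2 (J' c)
  rw [e1, MultilinearMap.map_sum, sum_apply]
  refine Finset.sum_congr rfl fun I _ => ?_
  rw [e2, MultilinearMap.map_sum]
  refine Finset.sum_congr rfl fun J _ => ?_
  rw [MultilinearMap.map_smul_univ, MultilinearMap.map_smul_univ, smul_apply]
  simp only [smul_eq_mul]
  ring

/-- The pairing induced on tensors does not depend on the basis. This holds for degenerate `g` too:
the junk inverse of a singular Gram matrix transforms like a genuine one. -/
theorem tensorPairing_change_basis (b b' : Module.Basis ι ℝ V) (g : LinearMap.BilinForm ℝ V)
    (f h : Tensor V k r) : tensorPairing b' g f h = tensorPairing b g f h := by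
  set P := b.toMatrix b' with hP
  set Q := b'.toMatrix b with hQ
  have hPQ : P * Q = 1 := b.toMatrix_mul_toMatrix_flip b'
  have hQP : Q * P = 1 := b'.toMatrix_mul_toMatrix_flip b
  have hg : Qᵀ * gram b' g * Q = gram b g := by
    rw [gram_change_basis b' b g]
  have hi : (gram b g)⁻¹ = P * (gram b' g)⁻¹ * Pᵀ := by
    have hT : Pᵀ * Qᵀ = 1 := by rw [← Matrix.transpose_mul, hQP, Matrix.transpose_one]
    rw [← hg, Matrix.mul_inv_rev, Matrix.mul_inv_rev, Matrix.inv_eq_left_inv hPQ,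
      Matrix.inv_eq_left_inv hT, Matrix.mul_assoc]
  have hW : pairingMatrix b g k r =
      (matrixPower k Q ⊗ₖ matrixPower r Pᵀ)ᵀ * pairingMatrix b' g k r *
        (matrixPower k Q ⊗ₖ matrixPower r Pᵀ) := by
    rw [pairingMatrix, pairingMatrix, ← Matrix.kroneckerMap_transpose, ← matrixPower_transpose,
      ← matrixPower_transpose, ← Matrix.mul_kronecker_mul, ← Matrix.mul_kronecker_mul,
      ← matrixPower_mul, ← matrixPower_mul, ← matrixPower_mul, ← matrixPower_mul, hg,
      Matrix.transpose_transpose, ← hi]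
  rw [tensorPairing_eq_dotProduct, tensorPairing_eq_dotProduct, hW, coeffVec_change_basis b b' f,
    coeffVec_change_basis b b' h, ← hQ, ← hP]
  rw [← Matrix.mulVec_mulVec, ← Matrix.mulVec_mulVec, Matrix.dotProduct_mulVec _ (_ᵀ),
    Matrix.vecMul_transpose]

/-- In an orthogonal basis the pairing of tensors is a weighted sum of products of components. -/
theorem tensorPairing_of_diagonal {b : Module.Basis ι ℝ V} {g : LinearMap.BilinForm ℝ V}
    {d : ι → ℝ} (hg : gram b g = Matrix.diagonal d) (hd : ∀ i, d i * d i = 1)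
    (f h : Tensor V k r) :
    tensorPairing b g f h =
      ∑ K, ((∏ a, d (K.1 a)) * ∏ c, d (K.2 c)) * (coeffVec b f K * coeffVec b h K) := by
  classical
  have hinv : (gram b g)⁻¹ = Matrix.diagonal d := by
    rw [hg]
    exact Matrix.inv_eq_left_inv (by simp [Matrix.diagonal_mul_diagonal, hd])
  have hpow : ∀ m : ℕ, matrixPower m (Matrix.diagonal d) =
      Matrix.diagonal fun I => ∏ a, d (I a) := by
    intro m
    ext I J
    rcases eq_or_ne I J with rfl | hIJ
    · simp [matrixPower]
    · obtain ⟨a, ha⟩ := Function.ne_iff.1 hIJ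
      rw [Matrix.diagonal_apply_ne _ hIJ]
      exact Finset.prod_eq_zero (Finset.mem_univ a) (Matrix.diagonal_apply_ne _ ha)
  rw [tensorPairing_eq_dotProduct, pairingMatrix, hinv, hg, hpow, hpow,
    Matrix.diagonal_kronecker_diagonal]
  simp only [dotProduct, Matrix.mulVec_diagonal]
  exact Finset.sum_congr rfl fun K _ => by ring

/-- A positive definite symmetric bilinear form has an orthonormal basis. -/
theorem exists_gram_eq_one [FiniteDimensional ℝ V] (B : LinearMap.BilinForm ℝ V)
    (hs : ∀ v w, B v w = B w v) (hp : ∀ v, v ≠ 0 → 0 < B v v) {m : ℕ}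
    (hm : Module.finrank ℝ V = m) :
    ∃ e : Module.Basis (Fin m) ℝ V, ∀ i j, B (e i) (e j) = if i = j then 1 else 0 := by
  subst hm
  obtain ⟨v, hv⟩ := LinearMap.BilinForm.exists_orthogonal_basis (B := B) ⟨fun v w => hs v w⟩
  have hpos : ∀ i, 0 < B (v i) (v i) := fun i => hp _ (v.ne_zero i)
  have hu : ∀ i, IsUnit (Real.sqrt (B (v i) (v i)))⁻¹ := fun i =>
    (inv_ne_zero (Real.sqrt_pos.2 (hpos i)).ne').isUnit
  refine ⟨v.isUnitSMul hu, fun i j => ?_⟩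
  simp only [Module.Basis.isUnitSMul_apply, map_smul, LinearMap.smul_apply, smul_eq_mul]
  split_ifs with hij
  · subst hij
    have := Real.mul_self_sqrt (hpos i).le
    have h0 := (Real.sqrt_pos.2 (hpos i)).ne'
    field_simp
    linarith
  · have : B (v i) (v j) = 0 := hv hij
    simp [this]

end Algebra

/-! ### Orthonormal frames of the product metrics and pointwise bounds -/

section Spacetime

variable {n : ℕ} {M : Type*} [TopologicalSpace M] [ChartedSpace (EuclideanSpace ℝ (Fin n)) M]
  [IsManifold (𝓡 n) ∞ M] {T : ℝ} {k r : ℕ}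

/-- The diagonal entries of `s dt² + G` in an orthonormal frame of `dt² + G` whose last vector
is `∂_t`. -/
noncomputable def frameSign (n : ℕ) (s : ℝ) : Fin n ⊕ Unit → ℝ :=
  Sum.elim (fun _ => 1) (fun _ => s)

/-- At every point, an orthonormal basis of `G` together with `∂_t` diagonalizes all the metrics
`s dt² + G` simultaneously. -/
theorem exists_adapted_basis (G : SpatialMetric n M) (p : Spacetime M T) :
    ∃ e : Module.Basis (Fin n ⊕ Unit) ℝ (Tan n p), ∀ s : ℝ,
      gram e (productMetric s G p) = Matrix.diagonal (frameSign n s) := by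
  let B : LinearMap.BilinForm ℝ (TangentSpace (𝓡 n) p.1) :=
    LinearMap.mk₂ ℝ (fun v w => G.inner p.1 v w)
      (fun v v' w => by rw [map_add]; rfl) (fun c v w => by rw [map_smul]; rfl)
      (fun v w w' => map_add _ _ _) (fun c v w => map_smul _ _ _)
  have : FiniteDimensional ℝ (TangentSpace (𝓡 n) p.1) :=
    inferInstanceAs (FiniteDimensional ℝ (EuclideanSpace ℝ (Fin n)))
  obtain ⟨e, he⟩ := exists_gram_eq_one B (fun v w => G.symm p.1 v w) (fun v hv => G.pos p.1 v hv)
    (finrank_euclideanSpace_fin (𝕜 := ℝ) (n := n))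
  let c : Module.Basis (Fin n ⊕ Unit) ℝ (TangentSpace (𝓡 n) p.1 × ℝ) :=
    e.prod (Module.Basis.singleton Unit ℝ)
  let c' : Module.Basis (Fin n ⊕ Unit) ℝ (Tan n p) := c
  refine ⟨c', fun s => ?_⟩
  have key : ∀ i j, gram c' (productMetric s G p) i j =
      s * ((c i).2 * (c j).2) + B (c i).1 (c j).1 := fun i j => rfl
  ext i j
  rw [key]
  rcases i with i | i <;> rcases j with j | j <;>
    simp [c, he, frameSign, Matrix.diagonal_apply]

theorem tensorPairing_comm (G : SpatialMetric n M) (p : Spacetime M T)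
    (f h : Tensor (Tan n p) k r) :
    tensorPairing (tanBasis n p) (minkowskiMetric G p) f h =
      tensorPairing (tanBasis n p) (minkowskiMetric G p) h f := by
  obtain ⟨e, he⟩ := exists_adapted_basis G p
  have hd : ∀ i, frameSign n (-1) i * frameSign n (-1) i = 1 := by
    rintro (i | i) <;> simp [frameSign]
  rw [← tensorPairing_change_basis (tanBasis n p) e, ← tensorPairing_change_basis (tanBasis n p) e,
    minkowskiMetric, tensorPairing_of_diagonal (he _) hd, tensorPairing_of_diagonal (he _) hd]
  exact Finset.sum_congr rfl fun K _ => by ring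

/-- A basis that diagonalizes the Minkowski metric, and in which the squared norm of `dt² + G` on
tensors is the sum of the squares of the components. -/
theorem exists_basis_tensorPairing_reference_eq (G : SpatialMetric n M) (p : Spacetime M T) :
    ∃ e : Module.Basis (Fin n ⊕ Unit) ℝ (Tan n p),
      gram e (minkowskiMetric G p) = Matrix.diagonal (frameSign n (-1)) ∧
      ∀ f : Tensor (Tan n p) k r,
        tensorPairing (tanBasis n p) (referenceMetric G p) f f = ∑ K, coeffVec e f K ^ 2 := by
  obtain ⟨e, he⟩ := exists_adapted_basis G p
  refine ⟨e, he _, fun f => ?_⟩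
  have hd : ∀ i, frameSign n 1 i = 1 := by
    rintro (i | i) <;> simp [frameSign]
  rw [← tensorPairing_change_basis (tanBasis n p) e, referenceMetric,
    tensorPairing_of_diagonal (he _) (fun i => by rw [hd]; norm_num)]
  exact Finset.sum_congr rfl fun K _ => by simp [hd, sq]

theorem tensorPairing_reference_nonneg (G : SpatialMetric n M) (p : Spacetime M T)
    (f : Tensor (Tan n p) k r) :
    0 ≤ tensorPairing (tanBasis n p) (referenceMetric G p) f f := by
  obtain ⟨e, -, he⟩ := exists_basis_tensorPairing_reference_eq (k := k) (r := r) G p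
  rw [he]
  positivity

theorem tensorPairing_reference_sub_le (G : SpatialMetric n M) (p : Spacetime M T)
    (f h : Tensor (Tan n p) k r) :
    tensorPairing (tanBasis n p) (referenceMetric G p) (f - h) (f - h) ≤
      2 * tensorPairing (tanBasis n p) (referenceMetric G p) f f +
        2 * tensorPairing (tanBasis n p) (referenceMetric G p) h h := by
  obtain ⟨e, -, he⟩ := exists_basis_tensorPairing_reference_eq (k := k) (r := r) G p
  rw [he, he, he, Finset.mul_sum, Finset.mul_sum, ← Finset.sum_add_distrib]
  refine Finset.sum_le_sum fun K _ => ?_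
  rw [coeffVec_sub, Pi.sub_apply]
  nlinarith [sq_nonneg (coeffVec e f K + coeffVec e h K)]

theorem abs_tensorPairing_minkowski_le (G : SpatialMetric n M) (p : Spacetime M T)
    (f h : Tensor (Tan n p) k r) :
    |tensorPairing (tanBasis n p) (minkowskiMetric G p) f h| ≤
      tensorPairing (tanBasis n p) (referenceMetric G p) f f +
        tensorPairing (tanBasis n p) (referenceMetric G p) h h := by
  obtain ⟨e, hm, he⟩ := exists_basis_tensorPairing_reference_eq (k := k) (r := r) G p
  have hd : ∀ i, frameSign n (-1) i * frameSign n (-1) i = 1 := by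
    rintro (i | i) <;> simp [frameSign]
  have habs : ∀ i, |frameSign n (-1) i| = 1 := by
    rintro (i | i) <;> simp [frameSign]
  rw [he, he, ← tensorPairing_change_basis (tanBasis n p) e, tensorPairing_of_diagonal hm hd,
    ← Finset.sum_add_distrib]
  refine (Finset.abs_sum_le_sum_abs _ _).trans (Finset.sum_le_sum fun K _ => ?_)
  rw [abs_mul, abs_mul, Finset.abs_prod, Finset.abs_prod]
  simp only [habs, Finset.prod_const_one, one_mul, abs_mul]
  nlinarith [sq_nonneg (|coeffVec e f K| - |coeffVec e h K|), sq_abs (coeffVec e f K),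
    sq_abs (coeffVec e h K), sq_nonneg (coeffVec e f K), sq_nonneg (coeffVec e h K)]

/-! ### Continuity of the metric components in a chart -/

theorem mem_baseSet_of_mem_source {x₀ p : Spacetime M T}
    (hp : p ∈ (extChartAt (stModel n) x₀).source) :
    p ∈ (trivializationAt (Model n) (TangentSpace (stModel n)) x₀).baseSet := by
  rwa [TangentBundle.trivializationAt_baseSet, ← extChartAt_source (stModel n)]

/-- The coordinate frame of the chart at `x₀`. -/
noncomputable def coordBasis {x₀ p : Spacetime M T} (hp : p ∈ (extChartAt (stModel n) x₀).source) :
    Module.Basis (Fin n ⊕ Unit) ℝ (Tan n p) :=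
  (stBasis n).map
    ((trivializationAt (Model n) (TangentSpace (stModel n)) x₀).continuousLinearEquivAt ℝ p
      (mem_baseSet_of_mem_source hp)).symm.toLinearEquiv

theorem coordBasis_apply {x₀ p : Spacetime M T} (hp : p ∈ (extChartAt (stModel n) x₀).source)
    (i : Fin n ⊕ Unit) : coordBasis hp i = coordVector n x₀ p i := by
  rw [coordBasis, Module.Basis.map_apply, coordVector]
  exact congrFun (Bundle.Trivialization.symm_continuousLinearEquivAt_eq _
    (mem_baseSet_of_mem_source hp)) _

theorem coordBasis_coord {x₀ p : Spacetime M T} (hp : p ∈ (extChartAt (stModel n) x₀).source)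
    (i : Fin n ⊕ Unit) : (coordBasis hp).coord i = coordCovector n x₀ p i := by
  refine LinearMap.ext fun v => ?_
  have h := congrFun (Bundle.Trivialization.coe_continuousLinearEquivAt_eq (R := ℝ)
    (trivializationAt (Model n) (TangentSpace (stModel n)) x₀) (mem_baseSet_of_mem_source hp)) v
  exact congrArg (fun w => (stBasis n).coord i w) h

theorem coeffVec_coordBasis {x₀ p : Spacetime M T} (hp : p ∈ (extChartAt (stModel n) x₀).source)
    (u : TensorField n M T k r) (K : (Fin k → Fin n ⊕ Unit) × (Fin r → Fin n ⊕ Unit)) :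
    coeffVec (coordBasis hp) (u p) K = chartCoeff x₀ u K.1 K.2 p := by
  simp only [coeffVec, Tensor.coeff, coordBasis_coord, coordBasis_apply, chartCoeff]

/-- The coordinate vector fields are continuous sections of the tangent bundle over the chart
domain. -/
theorem continuousOn_coordVector (x₀ : Spacetime M T) (i : Fin n ⊕ Unit) :
    ContinuousOn (fun p : Spacetime M T =>
      (⟨p, coordVector n x₀ p i⟩ : TangentBundle (stModel n) (Spacetime M T)))
      (extChartAt (stModel n) x₀).source := by
  set e := trivializationAt (Model n) (TangentSpace (stModel n)) x₀
  have h := e.continuousOn_symm.comp (f := fun p : Spacetime M T => (p, stBasis n i))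
    (s := (extChartAt (stModel n) x₀).source)
    (continuous_id.prodMk continuous_const).continuousOn
    fun p hp => ⟨mem_baseSet_of_mem_source hp, mem_univ _⟩
  refine h.congr fun p hp => ?_
  rw [coordVector, Bundle.Trivialization.symmL_apply _ (mem_baseSet_of_mem_source hp)]
  rfl

/-- The spatial part is the tangent map of the projection to `M`, hence continuous. -/
theorem continuousOn_spacePart (x₀ : Spacetime M T) (i : Fin n ⊕ Unit) :
    ContinuousOn (fun p : Spacetime M T =>
      (⟨p.1, spacePart n p (coordVector n x₀ p i)⟩ : TangentBundle (𝓡 n) M))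
      (extChartAt (stModel n) x₀).source := by
  have h : Continuous (tangentMap (stModel n) (𝓡 n) (Prod.fst : Spacetime M T → M)) :=
    (contMDiff_fst (n := ∞)).continuous_tangentMap (by simp)
  refine (h.comp_continuousOn (continuousOn_coordVector x₀ i)).congr fun p hp => ?_
  simp only [Function.comp_def, tangentMap, mfderiv_fst]
  rfl

omit [IsManifold (𝓡 n) ∞ M] in
/-- The time part of a tangent vector is the derivative of the time coordinate. The chart of the
interval inherited from `ℝ` is the inclusion, which makes this an identity in coordinates. -/
theorem mfderiv_time (p : Spacetime M T) (v : Tan n p) :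
    mfderiv (stModel n) 𝓘(ℝ, ℝ) (fun q : Spacetime M T => (q.2 : ℝ)) p v = timePart n p v := by
  have hd : MDifferentiableAt (stModel n) 𝓘(ℝ, ℝ) (fun q : Spacetime M T => (q.2 : ℝ)) p :=
    ((contMDiff_subtype_val.comp contMDiff_snd : ContMDiff (stModel n) 𝓘(ℝ, ℝ) ∞
      (fun q : Spacetime M T => (q.2 : ℝ))).mdifferentiable (by simp)) p
  have hw : writtenInExtChartAt (stModel n) 𝓘(ℝ, ℝ) p (fun q : Spacetime M T => (q.2 : ℝ))
      =ᶠ[𝓝 (extChartAt (stModel n) p p)] Prod.snd := by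
    have h := TopologicalSpace.Opens.chartAt_subtype_val_symm_eventuallyEq (H := ℝ)
      (TimeInterval T) (x := p.2)
    have h2 : Filter.Tendsto (Prod.snd : Model n → ℝ) (𝓝 (extChartAt (stModel n) p p))
      (𝓝 (chartAt ℝ (p.2 : ℝ) (p.2 : ℝ))) := continuous_snd.tendsto _
    filter_upwards [h2.eventually h] with y hy
    exact hy.symm
  have hr : range (stModel n) = univ := (stModel n).range_eq_univ
  rw [hd.mfderiv, hr, fderivWithin_univ, hw.fderiv_eq]
  exact congrArg (fun L : Model n →L[ℝ] ℝ => L v) fderiv_snd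

theorem continuousOn_timePart (x₀ : Spacetime M T) (i : Fin n ⊕ Unit) :
    ContinuousOn (fun p : Spacetime M T => timePart n p (coordVector n x₀ p i))
      (extChartAt (stModel n) x₀).source := by
  have h0 : ContMDiff (stModel n) 𝓘(ℝ, ℝ) ∞ (fun q : Spacetime M T => (q.2 : ℝ)) :=
    contMDiff_subtype_val.comp contMDiff_snd
  have h := h0.continuous_tangentMap (by simp)
  have h2 := (contMDiff_snd_tangentBundle_modelSpace ℝ 𝓘(ℝ, ℝ) (n := ∞)).continuous
  refine ((h2.comp h).comp_continuousOn (continuousOn_coordVector x₀ i)).congr fun p hp => ?_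
  simp only [Function.comp_def]
  exact (mfderiv_time p _).symm

theorem continuousOn_productMetric (s : ℝ) (G : SpatialMetric n M) (x₀ : Spacetime M T)
    (i j : Fin n ⊕ Unit) :
    ContinuousOn (fun p : Spacetime M T =>
      productMetric s G p (coordVector n x₀ p i) (coordVector n x₀ p j))
      (extChartAt (stModel n) x₀).source := by
  have hG : ContinuousOn (fun p : Spacetime M T =>
      G.inner p.1 (spacePart n p (coordVector n x₀ p i)) (spacePart n p (coordVector n x₀ p j)))
      (extChartAt (stModel n) x₀).source := by
    have := ContinuousOn.clm_bundle_apply₂ (F₁ := EuclideanSpace ℝ (Fin n))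
      (F₂ := EuclideanSpace ℝ (Fin n)) (E₃ := Bundle.Trivial M ℝ) (F₃ := ℝ)
      (b := fun p : Spacetime M T => p.1) (ψ := fun p => G.inner p.1)
      (G.contMDiff.continuous.comp continuous_fst).continuousOn
      (continuousOn_spacePart x₀ i) (continuousOn_spacePart x₀ j)
    exact (Bundle.Trivial.homeomorphProd M ℝ).continuous.snd.comp_continuousOn this
  exact (continuousOn_const.mul
    ((continuousOn_timePart x₀ i).mul (continuousOn_timePart x₀ j))).add hG

/-! ### Measurability and integrability of the pairing -/

section Measurability

variable [MeasurableSpace M] [BorelSpace M]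

/-- On a chart domain the pairing is computed in the coordinate frame, where it is a polynomial in
the components of the fields, of the metric and of the inverse metric. -/
theorem aemeasurable_tensorPairing_chart (s : ℝ) (G : SpatialMetric n M)
    (μ : Measure (Spacetime M T)) (x₀ : Spacetime M T) {u v : TensorField n M T k r}
    (hu : ∀ I J, AEStronglyMeasurable (chartCoeff x₀ u I J)
      (μ.restrict (extChartAt (stModel n) x₀).source))
    (hv : ∀ I J, AEStronglyMeasurable (chartCoeff x₀ v I J)
      (μ.restrict (extChartAt (stModel n) x₀).source)) :
    AEMeasurable (fun p => tensorPairing (tanBasis n p) (productMetric s G p) (u p) (v p))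
      (μ.restrict (extChartAt (stModel n) x₀).source) := by
  set S := (extChartAt (stModel n) x₀).source
  have hSm : MeasurableSet S := (isOpen_extChartAt_source x₀).measurableSet
  let g : Spacetime M T → Matrix (Fin n ⊕ Unit) (Fin n ⊕ Unit) ℝ := fun p => Matrix.of fun i j =>
    productMetric s G p (coordVector n x₀ p i) (coordVector n x₀ p j)
  have hg : ContinuousOn g S :=
    continuousOn_pi.2 fun i => continuousOn_pi.2 fun j => continuousOn_productMetric s G x₀ i j
  have hgm : ∀ i j, AEMeasurable (fun p => g p i j) (μ.restrict S) := fun i j =>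
    (continuousOn_productMetric s G x₀ i j).aemeasurable hSm
  -- The cofactor formula shows measurability without the determinant being nonzero.
  have hgi : ∀ i j, AEMeasurable (fun p => (g p)⁻¹ i j) (μ.restrict S) := fun i j => by
    have hdet : AEMeasurable (fun p => (g p).det) (μ.restrict S) :=
      ((continuous_id.matrix_det).comp_continuousOn hg).aemeasurable hSm
    have hadj : AEMeasurable (fun p => (g p).adjugate i j) (μ.restrict S) :=
      (((continuous_id.matrix_adjugate).matrix_elem i j).comp_continuousOn hg).aemeasurable hSm
    refine (hdet.inv.mul hadj).congr (Filter.Eventually.of_forall fun p => ?_)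
    simp only [Matrix.inv_def, Ring.inverse_eq_inv', Matrix.smul_apply, smul_eq_mul,
      Pi.mul_apply, Pi.inv_apply]
  have hF : AEMeasurable (fun p => ∑ I : Fin k → Fin n ⊕ Unit, ∑ I' : Fin k → Fin n ⊕ Unit,
      ∑ J : Fin r → Fin n ⊕ Unit, ∑ J' : Fin r → Fin n ⊕ Unit,
        (∏ a, g p (I a) (I' a)) * (∏ c, (g p)⁻¹ (J c) (J' c)) *
          chartCoeff x₀ u I J p * chartCoeff x₀ v I' J' p) (μ.restrict S) :=
    Finset.aemeasurable_fun_sum _ fun I _ => Finset.aemeasurable_fun_sum _ fun I' _ =>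
      Finset.aemeasurable_fun_sum _ fun J _ => Finset.aemeasurable_fun_sum _ fun J' _ =>
        (((Finset.aemeasurable_fun_prod _ fun a _ => hgm _ _).mul
          (Finset.aemeasurable_fun_prod _ fun c _ => hgi _ _)).mul
            (hu I J).aemeasurable).mul (hv I' J').aemeasurable
  refine hF.congr ((ae_restrict_iff' hSm).2 (Filter.Eventually.of_forall fun p hp => ?_))
  have hgram : gram (coordBasis hp) (productMetric s G p) = g p := by
    ext i j
    simp only [gram, Matrix.of_apply, coordBasis_apply, g]
  have hc : ∀ (w : TensorField n M T k r) I J,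
      (w p).coeff (coordBasis hp) I J = chartCoeff x₀ w I J p :=
    fun w I J => coeffVec_coordBasis hp w (I, J)
  refine Eq.trans ?_ (tensorPairing_change_basis (tanBasis n p) (coordBasis hp) _ _ _)
  simp only [tensorPairing, hgram, hc]

variable [CompactSpace M]

omit [IsManifold (𝓡 n) ∞ M] [MeasurableSpace M] [BorelSpace M] in
/-- A compact manifold is second countable, so countably many chart domains cover the space-time. -/
theorem exists_countable_chart_cover : ∃ C : Set (Spacetime M T), C.Countable ∧
    ⋃ x₀ : C, (extChartAt (stModel n) (x₀ : Spacetime M T)).source = univ := by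
  have : SecondCountableTopology M :=
    ChartedSpace.secondCountable_of_sigmaCompact (EuclideanSpace ℝ (Fin n)) M
  obtain ⟨C, hC, hcover⟩ := TopologicalSpace.countable_cover_nhds
    fun x₀ : Spacetime M T => extChartAt_source_mem_nhds (I := stModel n) x₀
  rw [biUnion_eq_iUnion] at hcover
  exact ⟨C, hC, hcover⟩

omit [IsManifold (𝓡 n) ∞ M] [BorelSpace M] in
theorem aemeasurable_of_charts {F : Spacetime M T → ℝ} {μ : Measure (Spacetime M T)}
    (hF : ∀ x₀ : Spacetime M T, AEMeasurable F (μ.restrict (extChartAt (stModel n) x₀).source)) :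
    AEMeasurable F μ := by
  obtain ⟨C, hC, hcover⟩ := exists_countable_chart_cover (n := n) (M := M) (T := T)
  have := hC.to_subtype
  rw [← Measure.restrict_univ (μ := μ), ← hcover]
  exact aemeasurable_iUnion_iff.2 fun x₀ => hF x₀

theorem aemeasurable_tensorPairing (s : ℝ) (G : SpatialMetric n M) {u v : TensorField n M T k r}
    (hu : MemL2 G u) (hv : MemL2 G v) :
    AEMeasurable (fun p => tensorPairing (tanBasis n p) (productMetric s G p) (u p) (v p))
      (volumeMeasure T G) :=
  aemeasurable_of_charts fun x₀ =>
    aemeasurable_tensorPairing_chart s G _ x₀ (hu.1 x₀) (hv.1 x₀)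

theorem MemL2.integrable_reference {G : SpatialMetric n M} {u : TensorField n M T k r}
    (hu : MemL2 G u) :
    Integrable (fun p => tensorPairing (tanBasis n p) (referenceMetric G p) (u p) (u p))
      (volumeMeasure T G) :=
  ⟨(aemeasurable_tensorPairing 1 G hu hu).aestronglyMeasurable,
    (hasFiniteIntegral_iff_ofReal (Filter.Eventually.of_forall fun p =>
      tensorPairing_reference_nonneg G p (u p))).2 hu.2⟩

theorem MemL2.integrable_minkowski {G : SpatialMetric n M} {u v : TensorField n M T k r}
    (hu : MemL2 G u) (hv : MemL2 G v) :
    Integrable (fun p => tensorPairing (tanBasis n p) (minkowskiMetric G p) (u p) (v p))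
      (volumeMeasure T G) :=
  (hu.integrable_reference.add hv.integrable_reference).mono'
    (aemeasurable_tensorPairing (-1) G hu hv).aestronglyMeasurable
    (Filter.Eventually.of_forall fun p => abs_tensorPairing_minkowski_le G p (u p) (v p))

theorem MemL2.sub {G : SpatialMetric n M} {u v : TensorField n M T k r}
    (hu : MemL2 G u) (hv : MemL2 G v) : MemL2 G (u - v) := by
  refine ⟨fun x₀ I J => (hu.1 x₀ I J).sub (hv.1 x₀ I J), lt_of_le_of_lt (lintegral_mono fun p =>
    ENNReal.ofReal_le_ofReal (tensorPairing_reference_sub_le G p (u p) (v p))) ?_⟩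
  have h := (hu.integrable_reference.const_mul 2).add (hv.integrable_reference.const_mul 2)
  exact (hasFiniteIntegral_iff_ofReal (Filter.Eventually.of_forall fun p => by
    have h1 := tensorPairing_reference_nonneg G p (u p)
    have h2 := tensorPairing_reference_nonneg G p (v p)
    exact add_nonneg (by positivity) (by positivity))).1 h.2

end Measurability

/-! ### The pairing on `L²` and the equivalence -/

section Pairing

variable [MeasurableSpace M]

theorem pairing_comm (G : SpatialMetric n M) (u v : TensorField n M T k r) :
    pairing G u v = pairing G v u :=
  integral_congr_ae (Filter.Eventually.of_forall fun p => tensorPairing_comm G p (u p) (v p))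

theorem pairing_congr_left {G : SpatialMetric n M} {u u' : TensorField n M T k r}
    (h : ∀ᵐ p ∂(volumeMeasure T G), u p = u' p) (v : TensorField n M T k r) :
    pairing G u v = pairing G u' v :=
  integral_congr_ae (h.mono fun p hp => by simp only [hp])

variable [BorelSpace M] [CompactSpace M]

theorem pairing_add_left {G : SpatialMetric n M} {u u' v : TensorField n M T k r}
    (hu : MemL2 G u) (hu' : MemL2 G u') (hv : MemL2 G v) :
    pairing G (u + u') v = pairing G u v + pairing G u' v := by
  rw [pairing, pairing, pairing,
    ← integral_add (hu.integrable_minkowski hv) (hu'.integrable_minkowski hv)]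
  exact integral_congr_ae (Filter.Eventually.of_forall fun p => tensorPairing_add_left _ _ _ _ _)

theorem pairing_sub_left {G : SpatialMetric n M} {u u' v : TensorField n M T k r}
    (hu : MemL2 G u) (hu' : MemL2 G u') (hv : MemL2 G v) :
    pairing G (u - u') v = pairing G u v - pairing G u' v := by
  rw [pairing, pairing, pairing,
    ← integral_sub (hu.integrable_minkowski hv) (hu'.integrable_minkowski hv)]
  exact integral_congr_ae (Filter.Eventually.of_forall fun p => tensorPairing_sub_left _ _ _ _ _)

/-- The equivalence for an arbitrary relation in place of `w = ∇_A ψ`. -/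
theorem hasOrthogonalDecomposition_iff_hasWeakSolution {k' r' : ℕ} {G : SpatialMetric n M}
    {AGrad : TensorField n M T k' r' → TensorField n M T k r → Prop} {u : TensorField n M T k r}
    (hu : MemL2 G u) :
    HasOrthogonalDecomposition G AGrad u ↔ HasWeakSolution G AGrad u := by
  constructor
  · rintro ⟨φ, w, v, hφ, hw, hw2, hv2, huwv, hdiv, -⟩
    refine ⟨φ, w, hφ, hw, hw2, fun ψ z hψ hz hz2 => ?_⟩
    rw [pairing_congr_left (u' := w + v) huwv, pairing_add_left hw2 hv2 hz2, pairing_comm G v,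
      hdiv ψ z hψ hz hz2, add_zero]
  · rintro ⟨φ, w, hφ, hw, hw2, hsol⟩
    have hdiv : IsDivAFree G AGrad (u - w) := fun ψ z hψ hz hz2 => by
      rw [pairing_comm, pairing_sub_left hu hw2 hz2, hsol ψ z hψ hz hz2, sub_self]
    exact ⟨φ, w, u - w, hφ, hw, hw2, hu.sub hw2, Filter.Eventually.of_forall 
      fun p => (add_sub_cancel (w p) (u p)).symm, hdiv, hdiv φ w hφ hw hw2⟩

end Pairing
end Spacetime

end MinkowskiDecomposition

open MinkowskiDecomposition
theorem theorem6p5 {n : ℕ} {M : Type*} [TopologicalSpace M] [T2Space M] [CompactSpace M]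
    [ChartedSpace (EuclideanSpace ℝ (Fin n)) M] [IsManifold (𝓡 n) ∞ M]
    [MeasurableSpace M] [BorelSpace M]
    (G : SpatialMetric n M) (T : ℝ) (hT : 0 < T) (k r : ℕ) :
    (∀ (A : ∀ p : Spacetime M T, Tan n p)
        (u : TensorField n M T (k + 1) r),
      MemL2 G u →
        (HasOrthogonalDecomposition G
            (IsContravariantAGrad G A) u ↔
          HasWeakSolution G
            (IsContravariantAGrad G A) u)) ∧
    (∀ (A : ∀ p : Spacetime M T,
          Module.Dual ℝ (Tan n p))
        (u : TensorField n M T k (r + 1)),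
      MemL2 G u →
        (HasOrthogonalDecomposition G
            (IsCovariantAGrad G A) u ↔
          HasWeakSolution G
            (IsCovariantAGrad G A) u)) :=
  ⟨fun _ _ hu => hasOrthogonalDecomposition_iff_hasWeakSolution hu,
    fun _ _ hu => hasOrthogonalDecomposition_iff_hasWeakSolution hu⟩
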